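/- Let $m\in C^2([0,1])$ and $V\in C([0,1])$ be real-valued, and suppose that $m'(x)>0$ for all $x\in(0,1)$ (so that $m'(0)=0$ and $m'(1)=0$ are allowed). For $D>0$ let $\lambda(D)$ denote the principal eigenvalue of $$-D\varphi''-m'(x)\varphi'+V(x)\varphi=\lambda(D)\varphi\ \text{ in }(0,1),\qquad \varphi'(0)=\varphi'(1)=0,$$ that is, the unique real number for which this problem has a solution $\varphi\in C^2([0,1])$ that is positive on $[0,1]$ (such a number exists for every $D>0$). Then $$\lim_{D\to0^+}\lambda(D)=\min\left\{V(0)+[m'']_+(0),\ V(1)\right\},$$ where $[a]_+=\max\{a,0\}$, and where $m''(0)$ is the one-sided second derivative of $m$ at $0$ if $m'(0)=0$, while by convention $m''(0)=+\infty$ if $m'(0)>0$ (so that the limit is then $V(1)$). -/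

import Mathlib

open Set Filter Topology

/-- The derivative of a function on `[0,1]`: two-sided at interior points, one-sided at `0` and
at `1`. -/
noncomputable def derivUnit (f : ℝ → ℝ) : ℝ → ℝ :=
  derivWithin f (Icc (0 : ℝ) 1)

/-- `φ ∈ C²([0,1])` is a positive (classical) eigenfunction, with eigenvalue `μ`, of
`-D φ'' - m' φ' + V φ = μ φ` in `(0,1)`, `φ'(0) = φ'(1) = 0`. -/
structure IsPositiveEigenfunction (m V : ℝ → ℝ) (D μ : ℝ) (φ : ℝ → ℝ) : Prop where
  contDiffOn : ContDiffOn ℝ 2 φ (Icc (0 : ℝ) 1)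
  pos : ∀ x ∈ Icc (0 : ℝ) 1, 0 < φ x
  equation : ∀ x ∈ Ioo (0 : ℝ) 1,
    -D * derivUnit (derivUnit φ) x - derivUnit m x * derivUnit φ x + V x * φ x = μ * φ x
  neumann_zero : derivUnit φ 0 = 0
  neumann_one : derivUnit φ 1 = 0

/-- `μ` is the principal eigenvalue of
`-D φ'' - m' φ' + V φ = μ φ` in `(0,1)`, `φ'(0) = φ'(1) = 0`:
the real eigenvalue that has a positive eigenfunction. -/
def IsPrincipalEigenvalue (m V : ℝ → ℝ) (D μ : ℝ) : Prop :=
  ∃ φ : ℝ → ℝ, IsPositiveEigenfunction m V D μ φ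

open Classical in
/-- The extended value of `m''(0)`: it is `+∞` if `m'(0) > 0`, `-∞` if `m'(0) < 0`, and the
ordinary (one-sided) second derivative `m''(0)` if `m'(0) = 0`. -/
noncomputable def secondDerivAtZero (m : ℝ → ℝ) : EReal :=
  if 0 < derivUnit m 0 then ⊤
  else if derivUnit m 0 < 0 then ⊥
  else ((derivUnit (derivUnit m) 0 : ℝ) : EReal)

/-- The positive part `[a]₊ = max {a, 0}` of an extended real. -/
noncomputable def erealPosPart (a : EReal) : EReal :=
  max a 0

/-! For an eigenfunction φ > 0 and a strict subsolution ψ, that is (V - μ)ψ < Dψ'' + m'ψ', the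
weighted Wronskian exp(m/D)(ψ'φ - ψφ') is strictly increasing. Any ψ whose boundary values prevent
this increase gives a bound on μ by contradiction. Uniqueness follows by testing one eigenfunction
against another; existence is by shooting.

The drift points towards 1, so the eigenvalue can always come down to V(1): a sine arch supported
near 1 shows this (`eventually_principalEigenvalue_lt_right`). If m'(0) = 0, the point 0 also
competes. There the operator resembles -Du'' - bxu', for which exp(-bx²/(2D)) has eigenvalue b; a
truncated Gaussian gives V(0) + b for every b > 0 above m''(0)
(`eventually_principalEigenvalue_lt_left`).

For the lower bound (`eventually_lt_principalEigenvalue`) a positive supersolution is built from its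
logarithmic derivative w = -(1 - x)(K + g), which turns the condition into a Riccati inequality. The
term g(x) = kx/(D + Bx²) mimics the Gaussian at scale √D and gains almost α near 0; the constant K
uses the drift to dominate V between the endpoints; the factor 1 - x restores the Neumann condition
at 1. -/

/-! ### Wronskian comparison and uniqueness -/

/-- Strict monotonicity of the weighted Wronskian `exp (m / D) * (ψ' φ - ψ φ')` of two functions
for the operator `u ↦ D u'' + m' u'`. -/
theorem wronskian_lt {D a b : ℝ} (hD : 0 < D) (hab : a < b)
    {m m₁ φ φ₁ φ₂ ψ ψ₁ ψ₂ : ℝ → ℝ}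
    (hmc : ContinuousOn m (Icc a b)) (hm : ∀ x ∈ Ioo a b, HasDerivAt m (m₁ x) x)
    (hφc : ContinuousOn φ (Icc a b)) (hφ : ∀ x ∈ Ioo a b, HasDerivAt φ (φ₁ x) x)
    (hφ₁c : ContinuousOn φ₁ (Icc a b)) (hφ₁ : ∀ x ∈ Ioo a b, HasDerivAt φ₁ (φ₂ x) x)
    (hψc : ContinuousOn ψ (Icc a b)) (hψ : ∀ x ∈ Ioo a b, HasDerivAt ψ (ψ₁ x) x)
    (hψ₁c : ContinuousOn ψ₁ (Icc a b)) (hψ₁ : ∀ x ∈ Ioo a b, HasDerivAt ψ₁ (ψ₂ x) x)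
    (hpos : ∀ x ∈ Ioo a b,
      0 < (D * ψ₂ x + m₁ x * ψ₁ x) * φ x - ψ x * (D * φ₂ x + m₁ x * φ₁ x)) :
    Real.exp (m a / D) * (ψ₁ a * φ a - ψ a * φ₁ a)
      < Real.exp (m b / D) * (ψ₁ b * φ b - ψ b * φ₁ b) := by
  have hmono : StrictMonoOn
      (fun x => Real.exp (m x / D) * (ψ₁ x * φ x - ψ x * φ₁ x)) (Icc a b) := by
    refine strictMonoOn_of_hasDerivWithinAt_pos (convex_Icc a b)
      (f' := fun x => Real.exp (m x / D) / D *
        ((D * ψ₂ x + m₁ x * ψ₁ x) * φ x - ψ x * (D * φ₂ x + m₁ x * φ₁ x))) ?_ ?_ ?_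
    · exact (Real.continuous_exp.comp_continuousOn (hmc.div_const D)).mul
        ((hψ₁c.mul hφc).sub (hψc.mul hφ₁c))
    · intro x hx
      rw [interior_Icc] at hx
      refine HasDerivAt.hasDerivWithinAt ?_
      have h := (((hm x hx).div_const D).exp).mul
        (((hψ₁ x hx).mul (hφ x hx)).sub ((hψ x hx).mul (hφ₁ x hx)))
      refine h.congr_deriv ?_
      simp only [Pi.mul_apply, Pi.sub_apply]
      field_simp
      ring
    · intro x hx
      rw [interior_Icc] at hx
      exact mul_pos (div_pos (Real.exp_pos _) hD) (hpos x hx)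
  exact hmono (left_mem_Icc.2 hab.le) (right_mem_Icc.2 hab.le) hab

section derivUnit

variable {f : ℝ → ℝ}

theorem derivUnit_hasDerivAt (hf : DifferentiableOn ℝ f (Icc (0 : ℝ) 1)) {x : ℝ}
    (hx : x ∈ Ioo (0 : ℝ) 1) : HasDerivAt f (derivUnit f x) x :=
  ((hf x (Ioo_subset_Icc_self hx)).hasDerivWithinAt).hasDerivAt (Icc_mem_nhds hx.1 hx.2)

theorem ContDiffOn.derivUnit_one (hf : ContDiffOn ℝ 2 f (Icc (0 : ℝ) 1)) :
    ContDiffOn ℝ 1 (derivUnit f) (Icc (0 : ℝ) 1) :=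
  hf.derivWithin (uniqueDiffOn_Icc zero_lt_one) (by norm_num)

theorem ContDiffOn.derivUnit_continuousOn (hf : ContDiffOn ℝ 2 f (Icc (0 : ℝ) 1)) :
    ContinuousOn (derivUnit f) (Icc (0 : ℝ) 1) :=
  hf.derivUnit_one.continuousOn

theorem ContDiffOn.hasDerivAt_derivUnit (hf : ContDiffOn ℝ 2 f (Icc (0 : ℝ) 1)) {x : ℝ}
    (hx : x ∈ Ioo (0 : ℝ) 1) : HasDerivAt f (derivUnit f x) x :=
  derivUnit_hasDerivAt (hf.differentiableOn (by norm_num)) hx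

theorem ContDiffOn.hasDerivAt_derivUnit_derivUnit (hf : ContDiffOn ℝ 2 f (Icc (0 : ℝ) 1)) {x : ℝ}
    (hx : x ∈ Ioo (0 : ℝ) 1) : HasDerivAt (derivUnit f) (derivUnit (derivUnit f) x) x :=
  derivUnit_hasDerivAt (hf.derivUnit_one.differentiableOn (by norm_num)) hx

end derivUnit

/-- Comparison of a positive eigenfunction with a test function on a subinterval. -/
theorem IsPositiveEigenfunction.wronskian_lt {m V φ ψ ψ₁ ψ₂ : ℝ → ℝ} {D μ a b : ℝ}
    (h : IsPositiveEigenfunction m V D μ φ) (hm : ContDiffOn ℝ 2 m (Icc (0 : ℝ) 1))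
    (hD : 0 < D) (ha : 0 ≤ a) (hab : a < b) (hb : b ≤ 1)
    (hψc : ContinuousOn ψ (Icc a b)) (hψ : ∀ x ∈ Ioo a b, HasDerivAt ψ (ψ₁ x) x)
    (hψ₁c : ContinuousOn ψ₁ (Icc a b)) (hψ₁ : ∀ x ∈ Ioo a b, HasDerivAt ψ₁ (ψ₂ x) x)
    (hpos : ∀ x ∈ Ioo a b, (V x - μ) * ψ x < D * ψ₂ x + derivUnit m x * ψ₁ x) :
    Real.exp (m a / D) * (ψ₁ a * φ a - ψ a * derivUnit φ a)
      < Real.exp (m b / D) * (ψ₁ b * φ b - ψ b * derivUnit φ b) := by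
  have hs : Icc a b ⊆ Icc (0 : ℝ) 1 := Icc_subset_Icc ha hb
  have hs' : Ioo a b ⊆ Ioo (0 : ℝ) 1 := Ioo_subset_Ioo ha hb
  refine _root_.wronskian_lt hD hab (hm.continuousOn.mono hs)
    (fun x hx => hm.hasDerivAt_derivUnit (hs' hx))
    (h.contDiffOn.continuousOn.mono hs) (fun x hx => h.contDiffOn.hasDerivAt_derivUnit (hs' hx))
    (h.contDiffOn.derivUnit_continuousOn.mono hs)
    (fun x hx => h.contDiffOn.hasDerivAt_derivUnit_derivUnit (hs' hx)) hψc hψ hψ₁c hψ₁ ?_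
  intro x hx
  have he := h.equation x (hs' hx)
  have h1 := mul_lt_mul_of_pos_right (hpos x hx) (h.pos x (hs (Ioo_subset_Icc_self hx)))
  have h2 : D * derivUnit (derivUnit φ) x + derivUnit m x * derivUnit φ x
      = (V x - μ) * φ x := by linarith
  rw [h2]
  linarith

/-- The principal eigenvalue is unique. -/
theorem IsPrincipalEigenvalue.eq {m V : ℝ → ℝ} {D μ ν : ℝ}
    (hm : ContDiffOn ℝ 2 m (Icc (0 : ℝ) 1)) (hD : 0 < D)
    (hμ : IsPrincipalEigenvalue m V D μ) (hν : IsPrincipalEigenvalue m V D ν) : μ = ν := by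
  have key : ∀ {μ ν : ℝ}, IsPrincipalEigenvalue m V D μ → IsPrincipalEigenvalue m V D ν →
      ¬ μ < ν := by
    rintro μ ν ⟨φ, hφ⟩ ⟨ψ, hψ⟩ hlt
    -- The eigenfunction of the smaller eigenvalue is a strict subsolution for the larger one, while
    -- the Neumann conditions make the Wronskian vanish at both ends.
    have h := hψ.wronskian_lt hm hD le_rfl zero_lt_one le_rfl hφ.contDiffOn.continuousOn
      (fun x hx => hφ.contDiffOn.hasDerivAt_derivUnit hx) hφ.contDiffOn.derivUnit_continuousOn
      (fun x hx => hφ.contDiffOn.hasDerivAt_derivUnit_derivUnit hx) (fun x hx => by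
        have he := hφ.equation x hx
        have := mul_pos (sub_pos.2 hlt) (hφ.pos x (Ioo_subset_Icc_self hx))
        linarith)
    simp [hφ.neumann_zero, hφ.neumann_one, hψ.neumann_zero, hψ.neumann_one] at h
  exact le_antisymm (not_lt.1 (key hν hμ)) (not_lt.1 (key hμ hν))

/-! ### Existence of the principal eigenvalue by shooting -/

/-- Global solvability of a linear initial value problem on `[0,1]`, with joint continuity in the
time variable and a parameter. -/
theorem exists_linear_ode_solution {E : Type*} [NormedAddCommGroup E] [NormedSpace ℝ E]
    [CompleteSpace E] {A : ℝ × ℝ → E →L[ℝ] E} (hA : Continuous A) {M : ℝ} (hM : ∀ p, ‖A p‖ ≤ M)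
    (u₀ : E) :
    ∃ U : ℝ → ℝ → E, Continuous (fun p : ℝ × ℝ => U p.1 p.2) ∧ (∀ l, U l 0 = u₀) ∧
      ∀ l, ∀ x ∈ Icc (0 : ℝ) 1, HasDerivAt (U l) (A (l, x) (U l x)) x := by
  have hM0 : 0 ≤ M := (norm_nonneg _).trans (hM 0)
  -- Weighting by exp(-Kx) with K > M makes the Picard map a contraction of ratio M/K on all of
  -- [0,1]. Working with bounded continuous functions of parameter and time together gives joint
  -- continuity at once.
  set K : ℝ := M + 1 with hK
  have hK0 : 0 < K := by linarith
  set c : ℝ → ℝ := fun x => max 0 (min x 1) with hc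
  have hcc : Continuous c := by fun_prop
  have hc0 : ∀ x, 0 ≤ c x := fun x => le_max_left _ _
  have hcx : ∀ x ∈ Icc (0 : ℝ) 1, c x = x := fun x hx => by
    simp only [hc, min_eq_left hx.2, max_eq_right hx.1]
  let G : (BoundedContinuousFunction (ℝ × ℝ) E) → ℝ → ℝ → E := fun f l t =>
    A (l, t) (Real.exp (K * t) • f (l, t))
  have hG : ∀ f, Continuous (fun p : ℝ × ℝ => G f p.1 p.2) := fun f => by
    have hf := f.continuous
    exact hA.clm_apply ((Real.continuous_exp.comp (continuous_const.mul continuous_snd)).smul hf)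
  have hGl : ∀ f l, Continuous (G f l) := fun f l => by
    have := (hG f).comp (Continuous.prodMk_right l)
    exact this
  have hint : ∀ f : BoundedContinuousFunction (ℝ × ℝ) E,
      Continuous (fun p : ℝ × ℝ => ∫ t in (0 : ℝ)..p.2, G f p.1 t) := fun f => by
    refine intervalIntegral.continuous_parametric_intervalIntegral_of_continuous
      (f := fun (p : ℝ × ℝ) t => G f p.1 t) ?_ continuous_snd
    exact (hG f).comp (by fun_prop : Continuous fun q : (ℝ × ℝ) × ℝ => (q.1.1, q.2))
  have hexp : ∀ y, 0 ≤ y → ∀ C, 0 ≤ C → ∀ g : ℝ → E,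
      (∀ t, ‖g t‖ ≤ M * (Real.exp (K * t) * C)) →
      ‖Real.exp (-(K * y)) • ∫ t in (0 : ℝ)..y, g t‖ ≤ M / K * C := by
    intro y hy C hC g hg
    have hderiv : ∀ t, HasDerivAt (fun t => M / K * C * Real.exp (K * t))
        (M * (Real.exp (K * t) * C)) t := fun t => by
      have := (((hasDerivAt_id t).const_mul K).exp).const_mul (M / K * C)
      refine this.congr_deriv ?_
      simp only [id]
      field_simp
    have hI : ∫ t in (0 : ℝ)..y, M * (Real.exp (K * t) * C)
        = M / K * C * Real.exp (K * y) - M / K * C * Real.exp (K * 0) := by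
      refine intervalIntegral.integral_eq_sub_of_hasDerivAt (fun t _ => hderiv t) ?_
      exact Continuous.intervalIntegrable (by fun_prop) _ _
    have hn : ‖∫ t in (0 : ℝ)..y, g t‖ ≤ M / K * C * Real.exp (K * y) := by
      calc ‖∫ t in (0 : ℝ)..y, g t‖ ≤ ∫ t in (0 : ℝ)..y, M * (Real.exp (K * t) * C) :=
            intervalIntegral.norm_integral_le_of_norm_le hy
              (Eventually.of_forall fun t _ => hg t)
              (Continuous.intervalIntegrable (by fun_prop) _ _)
        _ ≤ _ := by
            rw [hI]
            have : 0 ≤ M / K * C * Real.exp (K * 0) := by positivity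
            linarith
    rw [norm_smul, Real.norm_of_nonneg (Real.exp_pos _).le]
    calc Real.exp (-(K * y)) * ‖∫ t in (0 : ℝ)..y, g t‖
        ≤ Real.exp (-(K * y)) * (M / K * C * Real.exp (K * y)) := by gcongr
      _ = M / K * C * (Real.exp (-(K * y)) * Real.exp (K * y)) := by ring
      _ = M / K * C := by rw [← Real.exp_add]; simp
  have hGb : ∀ f l t, ‖G f l t‖ ≤ M * (Real.exp (K * t) * ‖f‖) := fun f l t => by
    calc ‖G f l t‖ ≤ ‖A (l, t)‖ * ‖Real.exp (K * t) • f (l, t)‖ := (A (l, t)).le_opNorm _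
      _ ≤ M * (Real.exp (K * t) * ‖f‖) := by
        rw [norm_smul, Real.norm_of_nonneg (Real.exp_pos _).le]
        gcongr
        · exact hM _
        · exact f.norm_coe_le_norm _
  let T : BoundedContinuousFunction (ℝ × ℝ) E → BoundedContinuousFunction (ℝ × ℝ) E := fun f =>
    BoundedContinuousFunction.ofNormedAddCommGroup
      (fun p : ℝ × ℝ => Real.exp (-(K * c p.2)) • (u₀ + ∫ t in (0 : ℝ)..c p.2, G f p.1 t))
      ((by fun_prop : Continuous fun p : ℝ × ℝ => Real.exp (-(K * c p.2))).smul
        (continuous_const.add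
          ((hint f).comp (by fun_prop : Continuous fun p : ℝ × ℝ => (p.1, c p.2)))))
      (‖u₀‖ + M / K * ‖f‖) (by
        intro p
        rw [smul_add]
        refine (norm_add_le _ _).trans (add_le_add ?_
          (hexp _ (hc0 _) _ (norm_nonneg _) _ (hGb f p.1)))
        rw [norm_smul, Real.norm_of_nonneg (Real.exp_pos _).le]
        refine mul_le_of_le_one_left (norm_nonneg _) (Real.exp_le_one_iff.2 ?_)
        have := mul_nonneg hK0.le (hc0 p.2)
        linarith)
  have hT : ContractingWith (Real.toNNReal (M / K)) T := by
    refine ⟨?_, ?_⟩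
    · rw [Real.toNNReal_lt_one, div_lt_one hK0]
      linarith
    · refine LipschitzWith.of_dist_le_mul fun f g => ?_
      have hMK : (0 : ℝ) ≤ M / K := div_nonneg hM0 hK0.le
      rw [Real.coe_toNNReal _ hMK,
        BoundedContinuousFunction.dist_le (mul_nonneg hMK dist_nonneg)]
      intro p
      simp only [T, BoundedContinuousFunction.coe_ofNormedAddCommGroup]
      rw [dist_eq_norm, ← smul_sub, add_sub_add_left_eq_sub,
        ← intervalIntegral.integral_sub ((hGl f _).intervalIntegrable _ _)
          ((hGl g _).intervalIntegrable _ _), dist_eq_norm]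
      refine hexp _ (hc0 _) _ (norm_nonneg _) _ fun t => ?_
      have : G f p.1 t - G g p.1 t = G (f - g) p.1 t := by
        simp only [G, ← map_sub, ← smul_sub, BoundedContinuousFunction.coe_sub, Pi.sub_apply]
      rw [this]
      exact hGb _ _ _
  have hne : Nonempty (BoundedContinuousFunction (ℝ × ℝ) E) := ⟨0⟩
  set f := hT.fixedPoint T with hf
  have hfix : T f = f := hT.fixedPoint_isFixedPt
  have hfx : ∀ l, ∀ x ∈ Icc (0 : ℝ) 1,
      Real.exp (K * x) • f (l, x) = u₀ + ∫ t in (0 : ℝ)..x, G f l t := by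
    intro l x hx
    have h1 : (T f) (l, x)
        = Real.exp (-(K * c x)) • (u₀ + ∫ t in (0 : ℝ)..c x, G f l t) := rfl
    rw [hfix, hcx x hx] at h1
    rw [h1, smul_smul, ← Real.exp_add]
    simp
  refine ⟨fun l x => u₀ + ∫ t in (0 : ℝ)..x, G f l t, continuous_const.add (hint f),
    fun l => by simp, fun l x hx => ?_⟩
  have h := (intervalIntegral.integral_hasDerivAt_right ((hGl f l).intervalIntegrable 0 x)
    (hGl f l).aestronglyMeasurable.stronglyMeasurableAtFilter
    (hGl f l).continuousAt).const_add u₀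
  refine h.congr_deriv ?_
  simp only [← hfx l x hx, G]

theorem contDiffOn_one_Icc_of_hasDerivAt {f g : ℝ → ℝ} {a b : ℝ} (hab : a < b)
    (hf : ∀ x ∈ Icc a b, HasDerivAt f (g x) x) (hg : ContinuousOn g (Icc a b)) :
    ContDiffOn ℝ 1 f (Icc a b) := by
  have hu := uniqueDiffOn_Icc hab
  rw [show (1 : WithTop ℕ∞) = 0 + 1 by norm_num, contDiffOn_succ_iff_derivWithin hu]
  refine ⟨fun x hx => (hf x hx).differentiableAt.differentiableWithinAt, by simp, ?_⟩
  exact contDiffOn_zero.2 (hg.congr fun x hx => (hf x hx).hasDerivWithinAt.derivWithin (hu x hx))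

theorem contDiffOn_two_Icc_of_hasDerivAt {f g h : ℝ → ℝ} {a b : ℝ} (hab : a < b)
    (hf : ∀ x ∈ Icc a b, HasDerivAt f (g x) x) (hg : ∀ x ∈ Icc a b, HasDerivAt g (h x) x)
    (hh : ContinuousOn h (Icc a b)) : ContDiffOn ℝ 2 f (Icc a b) := by
  have hu := uniqueDiffOn_Icc hab
  rw [show (2 : WithTop ℕ∞) = 1 + 1 by norm_num, contDiffOn_succ_iff_derivWithin hu]
  refine ⟨fun x hx => (hf x hx).differentiableAt.differentiableWithinAt, by simp, ?_⟩
  exact (contDiffOn_one_Icc_of_hasDerivAt hab hg hh).congr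
    fun x hx => (hf x hx).hasDerivWithinAt.derivWithin (hu x hx)

theorem HasDerivAt.nonpos_of_isMinOn_left {f : ℝ → ℝ} {f' a b : ℝ} (hab : a < b)
    (hf : HasDerivAt f f' b) (hmin : ∀ x ∈ Icc a b, f b ≤ f x) : f' ≤ 0 := by
  have h := (hasDerivAt_iff_tendsto_slope.1 hf).mono_left
    (nhdsWithin_mono b (fun x (hx : x ∈ Iio b) => ne_of_lt hx))
  refine le_of_tendsto h ?_
  filter_upwards [Ioo_mem_nhdsLT hab] with x hx
  rw [slope_def_field]
  exact div_nonpos_of_nonneg_of_nonpos (sub_nonneg.2 (hmin x (Ioo_subset_Icc_self hx)))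
    (sub_nonpos.2 hx.2.le)

/-- For coefficients continuous on the interval, the solutions of the initial value problem
`D φ'' + b φ' = (v - l) φ`, `φ 0 = 1`, `φ' 0 = 0` on `[0,1]` for `l ∈ [lo, hi]`. -/
theorem exists_shooting_family {b v : ℝ → ℝ} (hb : ContinuousOn b (Icc (0 : ℝ) 1))
    (hv : ContinuousOn v (Icc (0 : ℝ) 1)) (D : ℝ) {lo hi : ℝ} (hlo : lo ≤ hi) :
    ∃ φ ψ : ℝ → ℝ → ℝ, Continuous (fun p : ℝ × ℝ => φ p.1 p.2) ∧
      Continuous (fun p : ℝ × ℝ => ψ p.1 p.2) ∧ (∀ l, φ l 0 = 1) ∧ (∀ l, ψ l 0 = 0) ∧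
      ∀ l ∈ Icc lo hi, (∀ x ∈ Icc (0 : ℝ) 1, HasDerivAt (φ l) (ψ l x) x ∧
        HasDerivAt (ψ l) (((v x - l) * φ l x - b x * ψ l x) / D) x) ∧
        ∀ x ∈ Icc (0 : ℝ) 1, φ l x = 0 → ψ l x ≠ 0 := by
  set b' : ℝ → ℝ := IccExtend zero_le_one ((Icc (0 : ℝ) 1).domRestrict b) with hb'
  set v' : ℝ → ℝ := IccExtend zero_le_one ((Icc (0 : ℝ) 1).domRestrict v) with hv'
  have hb'c : Continuous b' := (continuousOn_iff_continuous_domRestrict.1 hb).Icc_extend'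
  have hv'c : Continuous v' := (continuousOn_iff_continuous_domRestrict.1 hv).Icc_extend'
  have hbe : ∀ x ∈ Icc (0 : ℝ) 1, b' x = b x := fun x hx => by
    rw [hb', IccExtend_of_mem _ _ hx]; rfl
  have hve : ∀ x ∈ Icc (0 : ℝ) 1, v' x = v x := fun x hx => by
    rw [hv', IccExtend_of_mem _ _ hx]; rfl
  obtain ⟨Mb, hMb⟩ := isCompact_Icc.exists_bound_of_continuousOn hb
  obtain ⟨Mv, hMv⟩ := isCompact_Icc.exists_bound_of_continuousOn hv
  have hMb' : ∀ x, ‖b' x‖ ≤ Mb := fun x => hMb _ (projIcc (0 : ℝ) 1 zero_le_one x).2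
  have hMv' : ∀ x, ‖v' x‖ ≤ Mv := fun x => hMv _ (projIcc (0 : ℝ) 1 zero_le_one x).2
  -- Clamping the parameter keeps the coefficient matrix bounded on the whole plane.
  set c : ℝ → ℝ := fun l => max lo (min l hi) with hc
  have hcl : ∀ l ∈ Icc lo hi, c l = l := fun l hl => by
    simp only [hc, min_eq_left hl.2, max_eq_right hl.1]
  have hcb : ∀ l, ‖c l‖ ≤ |lo| + |hi| := fun l => by
    rw [Real.norm_eq_abs, abs_le]
    have h1 : lo ≤ c l := le_max_left _ _
    have h2 : c l ≤ hi := max_le hlo (min_le_right _ _)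
    constructor <;> linarith [neg_abs_le lo, abs_nonneg lo, abs_nonneg hi, le_abs_self hi]
  set A₁ : ℝ × ℝ →L[ℝ] ℝ × ℝ :=
    (ContinuousLinearMap.inr ℝ ℝ ℝ).comp (ContinuousLinearMap.fst ℝ ℝ ℝ)
  set A₂ : ℝ × ℝ →L[ℝ] ℝ × ℝ :=
    (ContinuousLinearMap.inr ℝ ℝ ℝ).comp (ContinuousLinearMap.snd ℝ ℝ ℝ)
  set A₃ : ℝ × ℝ →L[ℝ] ℝ × ℝ :=
    (ContinuousLinearMap.inl ℝ ℝ ℝ).comp (ContinuousLinearMap.snd ℝ ℝ ℝ)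
  set A : ℝ × ℝ → ℝ × ℝ →L[ℝ] ℝ × ℝ := fun p =>
    A₃ + ((v' p.2 - c p.1) / D) • A₁ - (b' p.2 / D) • A₂ with hA
  have hcc : Continuous c := by fun_prop
  have hAc : Continuous A := by fun_prop
  have hAb : ∀ p, ‖A p‖ ≤ ‖A₃‖ + (Mv + (|lo| + |hi|)) / ‖D‖ * ‖A₁‖ + Mb / ‖D‖ * ‖A₂‖ := by
    intro p
    refine (norm_sub_le _ _).trans (add_le_add ((norm_add_le _ _).trans
      (add_le_add le_rfl ?_)) ?_)
    · rw [norm_smul, norm_div]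
      gcongr
      exact (norm_sub_le _ _).trans (add_le_add (hMv' _) (hcb _))
    · rw [norm_smul, norm_div]
      gcongr
      exact hMb' _
  obtain ⟨U, hUc, hU0, hU⟩ := exists_linear_ode_solution hAc hAb ((1 : ℝ), (0 : ℝ))
  refine ⟨fun l x => (U l x).1, fun l x => (U l x).2, hUc.fst, hUc.snd, fun l => by simp [hU0],
    fun l => by simp [hU0], fun l hl => ⟨fun x hx => ⟨?_, ?_⟩, fun x hx h1 h2 => ?_⟩⟩
  · refine ((ContinuousLinearMap.fst ℝ ℝ ℝ).hasFDerivAt.comp_hasDerivAt x (hU l x hx)).congr_deriv ?_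
    simp [hA, A₁, A₂, A₃]
  · refine ((ContinuousLinearMap.snd ℝ ℝ ℝ).hasFDerivAt.comp_hasDerivAt x (hU l x hx)).congr_deriv ?_
    simp only [hA, A₁, A₂, A₃, hcl l hl, hbe x hx, hve x hx]
    simp
    ring
  · have hz : U l x = 0 := Prod.ext h1 h2
    have hsub : ∀ t ∈ Icc 0 x, t ∈ Icc (0 : ℝ) 1 := fun t ht => ⟨ht.1, ht.2.trans hx.2⟩
    set M := ‖A₃‖ + (Mv + (|lo| + |hi|)) / ‖D‖ * ‖A₁‖ + Mb / ‖D‖ * ‖A₂‖ with hM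
    -- Were φ and φ' both zero at x, backward uniqueness would make the solution vanish at 0,
    -- against φ(0) = 1.
    have heq := ODE_solution_unique_of_mem_Icc_left (v := fun t u => A (l, t) u)
      (s := fun _ => univ) (K := M.toNNReal) (f := U l) (g := fun _ => 0) (a := 0) (b := x)
      (fun t _ => ((A (l, t)).lipschitz.weaken (by
        rw [← norm_toNNReal]; exact Real.toNNReal_le_toNNReal (hAb _))).lipschitzOnWith)
      (fun t ht => (hU l t (hsub t ht)).continuousAt.continuousWithinAt)
      (fun t ht => (hU l t (hsub t (Ioc_subset_Icc_self ht))).hasDerivWithinAt)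
      (fun _ _ => mem_univ _) continuousOn_const
      (fun t _ => by simpa using hasDerivWithinAt_const (c := (0 : ℝ × ℝ)) t (Iic t))
      (fun _ _ => mem_univ _) hz
    have := heq (left_mem_Icc.2 hx.1)
    rw [hU0] at this
    simp at this

/-- Existence of the principal eigenvalue, by shooting. -/
theorem exists_isPrincipalEigenvalue {m V : ℝ → ℝ} {D : ℝ}
    (hm : ContDiffOn ℝ 2 m (Icc (0 : ℝ) 1)) (hV : ContinuousOn V (Icc (0 : ℝ) 1)) (hD : 0 < D) :
    ∃ μ, IsPrincipalEigenvalue m V D μ := by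
  obtain ⟨M, hM⟩ := isCompact_Icc.exists_bound_of_continuousOn hV
  have hM0 : 0 ≤ M := (norm_nonneg _).trans (hM 0 (by simp))
  have hMl : ∀ x ∈ Icc (0 : ℝ) 1, -M ≤ V x ∧ V x ≤ M := fun x hx => abs_le.1 (hM x hx)
  have hlohi : -M - 1 ≤ M + 1 := by linarith
  obtain ⟨φ, ψ, hφc, hψc, hφ0, hψ0, hode⟩ :=
    exists_shooting_family hm.derivUnit_continuousOn hV D hlohi
  have hφl : ∀ l, Continuous (φ l) := fun l => hφc.comp (Continuous.prodMk_right l)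
  have hψl : ∀ l, Continuous (ψ l) := fun l => hψc.comp (Continuous.prodMk_right l)
  have hφx : ∀ x, Continuous (fun l => φ l x) := fun x => hφc.comp (Continuous.prodMk_left x)
  have hψx : ∀ x, Continuous (fun l => ψ l x) := fun x => hψc.comp (Continuous.prodMk_left x)
  -- Wronskian against the constant 1: exp(m/D)φ' starts at 0 and has the sign of V - l as long as φ
  -- > 0. The factor σ = ±1 covers both signs.
  have hψsign : ∀ l ∈ Icc (-M - 1) (M + 1), ∀ σ : ℝ, (∀ t ∈ Icc (0 : ℝ) 1, 0 < σ * (V t - l)) →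
      ∀ x ∈ Ioc (0 : ℝ) 1, (∀ t ∈ Ioo 0 x, 0 < φ l t) → 0 < σ * ψ l x := by
    intro l hl σ hσ x hx hpos
    have hs : ∀ t ∈ Ioo 0 x, t ∈ Ioo (0 : ℝ) 1 := fun t ht => ⟨ht.1, ht.2.trans_le hx.2⟩
    have h := _root_.wronskian_lt (φ := fun _ => 1) (φ₁ := fun _ => 0) (φ₂ := fun _ => 0)
      (ψ := fun t => σ * φ l t) (ψ₁ := fun t => σ * ψ l t)
      (ψ₂ := fun t => σ * (((V t - l) * φ l t - derivUnit m t * ψ l t) / D)) hD hx.1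
      (hm.continuousOn.mono (Icc_subset_Icc le_rfl hx.2))
      (fun t ht => hm.hasDerivAt_derivUnit (hs t ht)) continuousOn_const
      (fun t _ => hasDerivAt_const t 1) continuousOn_const (fun t _ => hasDerivAt_const t 0)
      (continuous_const.mul (hφl l)).continuousOn
      (fun t ht => (((hode l hl).1 t (Ioo_subset_Icc_self (hs t ht))).1).const_mul σ)
      (continuous_const.mul (hψl l)).continuousOn
      (fun t ht => (((hode l hl).1 t (Ioo_subset_Icc_self (hs t ht))).2).const_mul σ)
      (fun t ht => by
        have := mul_pos (hσ t (Ioo_subset_Icc_self (hs t ht))) (hpos t ht)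
        field_simp
        linarith)
    simp only [hψ0, mul_zero, mul_one, sub_zero] at h
    exact (pos_iff_pos_of_mul_pos h).1 (Real.exp_pos _)
  -- The eigenvalue is the largest l in S. At this maximum φ > 0 persists for slightly larger l, so
  -- φ'(1) > 0 would contradict maximality.
  set S : Set ℝ := Icc (-M - 1) (M + 1) ∩
    ({l | ∀ x ∈ Icc (0 : ℝ) 1, 0 ≤ φ l x} ∩ {l | 0 ≤ ψ l 1}) with hS
  have hSpos : ∀ l ∈ S, ∀ x ∈ Icc (0 : ℝ) 1, 0 < φ l x := by
    rintro l ⟨hl, hnn, h1⟩ x hx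
    refine lt_of_le_of_ne (hnn x hx) fun h0 => ?_
    -- A zero of the nonnegative φ is a minimum, so φ' vanishes there too. At x = 1 the minimum
    -- gives only φ' ≤ 0, and membership in S supplies φ'(1) ≥ 0.
    refine (hode l hl).2 x hx h0.symm ?_
    have hd := ((hode l hl).1 x hx).1
    have hx0 : 0 < x := lt_of_le_of_ne hx.1 (by rintro rfl; rw [hφ0] at h0; norm_num at h0)
    rcases eq_or_lt_of_le hx.2 with rfl | hx1
    · exact le_antisymm (hd.nonpos_of_isMinOn_left zero_lt_one
        fun t ht => h0.symm.le.trans (hnn t ht)) h1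
    · have hmin : IsLocalMin (φ l) x := by
        filter_upwards [Icc_mem_nhds hx0 hx1] with t ht
        exact h0.symm.le.trans (hnn t ht)
      exact hmin.hasDerivAt_eq_zero hd
  have hlo : -M - 1 ∈ S := by
    have hl : -M - 1 ∈ Icc (-M - 1) (M + 1) := left_mem_Icc.2 hlohi
    have hσ : ∀ t ∈ Icc (0 : ℝ) 1, 0 < 1 * (V t - (-M - 1)) := fun t ht => by
      linarith [(hMl t ht).1]
    have hpos : ∀ x ∈ Icc (0 : ℝ) 1, 0 < φ (-M - 1) x := by
      by_contra! hcon
      obtain ⟨y, hy, hy0⟩ := hcon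
      have hcomp : IsCompact (Icc (0 : ℝ) 1 ∩ {x | φ (-M - 1) x ≤ 0}) :=
        isCompact_Icc.inter_right (isClosed_le (hφl _) continuous_const)
      obtain ⟨x, ⟨hx, hx0⟩, hleast⟩ := hcomp.exists_isLeast ⟨y, hy, hy0⟩
      have hxpos : 0 < x := lt_of_le_of_ne hx.1 (by
        rintro rfl; simp only [mem_ofPred_eq, hφ0] at hx0; norm_num at hx0)
      have hbefore : ∀ t ∈ Ico 0 x, 0 < φ (-M - 1) t := fun t ht => by
        by_contra! h
        exact absurd (hleast ⟨⟨ht.1, ht.2.le.trans hx.2⟩, h⟩) (not_le.2 ht.2)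
      have hmono : StrictMonoOn (φ (-M - 1)) (Icc 0 x) := by
        refine strictMonoOn_of_hasDerivWithinAt_pos (convex_Icc 0 x) (f' := ψ (-M - 1))
          (hφl _).continuousOn ?_ ?_ <;> intro t ht <;> rw [interior_Icc] at ht
        · exact ((hode _ hl).1 t ⟨ht.1.le, ht.2.le.trans hx.2⟩).1.hasDerivWithinAt
        · have := hψsign _ hl 1 hσ t ⟨ht.1, ht.2.le.trans hx.2⟩
            fun s hs => hbefore s ⟨hs.1.le, hs.2.trans ht.2⟩
          simpa using this
      have := hmono (left_mem_Icc.2 hx.1) (right_mem_Icc.2 hx.1) hxpos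
      rw [hφ0] at this
      simp only [mem_ofPred_eq] at hx0
      linarith
    refine ⟨hl, fun x hx => (hpos x hx).le, ?_⟩
    have := hψsign _ hl 1 hσ 1 (by simp) fun s hs => hpos s (Ioo_subset_Icc_self hs)
    rw [one_mul] at this
    exact this.le
  have hScomp : IsCompact S := by
    refine isCompact_Icc.inter_right (IsClosed.inter ?_ (isClosed_le continuous_const (hψx 1)))
    simp only [ofPred_forall]
    exact isClosed_biInter fun x _ => isClosed_le continuous_const (hφx x)
  obtain ⟨l, hlS, hlmax⟩ := hScomp.exists_isGreatest ⟨_, hlo⟩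
  have hl := hlS.1
  have hpos := hSpos l hlS
  have hllt : l < M + 1 := by
    refine lt_of_le_of_ne hl.2 fun h => ?_
    have := hψsign l hl (-1) (fun t ht => by linarith [(hMl t ht).2]) 1 (by simp)
      fun s hs => hpos s (Ioo_subset_Icc_self hs)
    have h1 : 0 ≤ ψ l 1 := hlS.2.2
    linarith
  have hψ1 : ψ l 1 = 0 := by
    by_contra hne
    have h1 : 0 < ψ l 1 := lt_of_le_of_ne hlS.2.2 (Ne.symm hne)
    have e1 : ∀ᶠ k in 𝓝 l, ∀ x ∈ Icc (0 : ℝ) 1, 0 < φ k x :=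
      isCompact_Icc.eventually_forall_of_forall_eventually fun x hx =>
        hφc.continuousAt.eventually (lt_mem_nhds (hpos x hx))
    have e2 : ∀ᶠ k in 𝓝 l, 0 < ψ k 1 := (hψx 1).continuousAt.eventually (lt_mem_nhds h1)
    have e3 : ∀ᶠ k in 𝓝 l, k < M + 1 := gt_mem_nhds hllt
    obtain ⟨k, ⟨hk1, hk2, hk3⟩, hk⟩ :=
      ((((e1.and (e2.and e3)).filter_mono nhdsWithin_le_nhds).and
        (self_mem_nhdsWithin : Ioi l ∈ 𝓝[>] l)).exists)
    exact absurd (hlmax ⟨⟨hl.1.trans (le_of_lt hk), hk3.le⟩, fun x hx => (hk1 x hx).le, hk2.le⟩)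
      (not_le.2 hk)
  have hu := uniqueDiffOn_Icc (zero_lt_one (α := ℝ))
  have hder : EqOn (derivUnit (φ l)) (ψ l) (Icc 0 1) := fun x hx =>
    ((hode l hl).1 x hx).1.hasDerivWithinAt.derivWithin (hu x hx)
  refine ⟨l, φ l, ?_, hpos, ?_, ?_, ?_⟩
  · refine contDiffOn_two_Icc_of_hasDerivAt zero_lt_one (fun x hx => ((hode l hl).1 x hx).1)
      (fun x hx => ((hode l hl).1 x hx).2) ?_
    exact (((hV.sub continuousOn_const).mul (hφl l).continuousOn).sub
      (hm.derivUnit_continuousOn.mul (hψl l).continuousOn)).div_const D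
  · intro x hx
    have hx' := Ioo_subset_Icc_self hx
    have h2 : derivUnit (derivUnit (φ l)) x
        = ((V x - l) * φ l x - derivUnit m x * ψ l x) / D := by
      have : derivUnit (derivUnit (φ l)) x = derivUnit (ψ l) x := derivWithin_congr hder (hder hx')
      rw [this]
      exact ((hode l hl).1 x hx').2.hasDerivWithinAt.derivWithin (hu x hx')
    rw [h2, hder hx']
    field_simp
    ring
  · rw [hder (by simp), hψ0]
  · rw [hder (by simp), hψ1]

/-! ### Endpoint localization and upper bounds -/

theorem ContinuousOn.exists_forall_Icc_zero {f : ℝ → ℝ} (hf : ContinuousOn f (Icc (0 : ℝ) 1))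
    {U : Set ℝ} (hU : U ∈ 𝓝 (f 0)) :
    ∃ δ ∈ Ioo (0 : ℝ) 1, ∀ x ∈ Icc 0 δ, f x ∈ U := by
  have h := (hf 0 (by simp)).eventually hU
  rw [nhdsWithin_Icc_eq_nhdsGE zero_lt_one] at h
  obtain ⟨u, hu, hu'⟩ := (mem_nhdsGE_iff_exists_Icc_subset).1 h
  refine ⟨min u (1 / 2), ⟨lt_min hu (by norm_num), (min_le_right _ _).trans_lt (by norm_num)⟩,
    fun x hx => hu' ⟨hx.1, hx.2.trans (min_le_left _ _)⟩⟩

theorem ContinuousOn.exists_forall_Icc_one {f : ℝ → ℝ} (hf : ContinuousOn f (Icc (0 : ℝ) 1))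
    {U : Set ℝ} (hU : U ∈ 𝓝 (f 1)) :
    ∃ c ∈ Ioo (0 : ℝ) 1, ∀ x ∈ Icc c 1, f x ∈ U := by
  have h := (hf 1 (by simp)).eventually hU
  rw [nhdsWithin_Icc_eq_nhdsLE zero_lt_one] at h
  obtain ⟨u, hu, hu'⟩ := (mem_nhdsLE_iff_exists_Icc_subset).1 h
  refine ⟨max u (1 / 2), ⟨lt_max_of_lt_right (by norm_num), max_lt hu (by norm_num)⟩,
    fun x hx => hu' ⟨(le_max_left _ _).trans hx.1, hx.2⟩⟩

section UpperBounds

variable {m V lam : ℝ → ℝ}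

/-- Asymptotic upper bound for the principal eigenvalue coming from the endpoint `1`, towards which
the drift points. -/
theorem eventually_principalEigenvalue_lt_right (hm : ContDiffOn ℝ 2 m (Icc (0 : ℝ) 1))
    (hV : ContinuousOn V (Icc (0 : ℝ) 1)) (hm_pos : ∀ x ∈ Ioo (0 : ℝ) 1, 0 < derivUnit m x)
    (hlam : ∀ D : ℝ, 0 < D → IsPrincipalEigenvalue m V D (lam D)) {ε : ℝ} (hε : 0 < ε) :
    ∀ᶠ D in 𝓝[>] (0 : ℝ), lam D < V 1 + ε := by
  obtain ⟨c, hc, hVc⟩ := hV.exists_forall_Icc_one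
    (Iio_mem_nhds (show V 1 < V 1 + ε / 2 by linarith))
  have h1c : 0 < 1 - c := sub_pos.2 hc.2
  -- A quarter period on [c, 1]: the sine vanishes at c and has zero slope at 1. It increases, so
  -- the drift term only helps.
  set κ : ℝ := Real.pi / 2 / (1 - c) with hκ
  have hκ0 : 0 < κ := by positivity
  have hκc : κ * (1 - c) = Real.pi / 2 := by rw [hκ]; field_simp
  have hsmall : ∀ᶠ D in 𝓝[>] (0 : ℝ), D * κ ^ 2 < ε / 2 := by
    have : Tendsto (fun D : ℝ => D * κ ^ 2) (𝓝[>] 0) (𝓝 (0 * κ ^ 2)) :=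
      ((continuous_id.mul continuous_const).tendsto 0).mono_left nhdsWithin_le_nhds
    rw [zero_mul] at this
    exact this.eventually (gt_mem_nhds (by linarith))
  filter_upwards [hsmall, self_mem_nhdsWithin] with D hDs hD
  rw [mem_Ioi] at hD
  by_contra! hcon
  obtain ⟨φ, hφ⟩ := hlam D hD
  have hlin : ∀ x, HasDerivAt (fun x => κ * (x - c)) κ x := fun x => by
    simpa using ((hasDerivAt_id x).sub_const c).const_mul κ
  have h := hφ.wronskian_lt (ψ := fun x => Real.sin (κ * (x - c)))
    (ψ₁ := fun x => κ * Real.cos (κ * (x - c)))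
    (ψ₂ := fun x => -κ ^ 2 * Real.sin (κ * (x - c))) hm hD hc.1.le hc.2 le_rfl
    (by fun_prop) (fun x _ => ((hlin x).sin).congr_deriv (by ring))
    (by fun_prop) (fun x _ => (((hlin x).cos).const_mul κ).congr_deriv (by ring)) (by
      intro x hx
      have hy0 : 0 < κ * (x - c) := mul_pos hκ0 (sub_pos.2 hx.1)
      have hy1 : κ * (x - c) < Real.pi / 2 := by
        rw [← hκc]
        exact mul_lt_mul_of_pos_left (by linarith [hx.2]) hκ0
      have hsin := Real.sin_pos_of_pos_of_lt_pi hy0 (by linarith [Real.pi_pos])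
      have hcos := Real.cos_pos_of_mem_Ioo ⟨by linarith [Real.pi_pos], hy1⟩
      have hV' : V x < V 1 + ε / 2 := hVc x (Ioo_subset_Icc_self hx)
      have h1 : 0 < derivUnit m x * (κ * Real.cos (κ * (x - c))) :=
        mul_pos (hm_pos x ⟨hc.1.trans hx.1, hx.2⟩) (mul_pos hκ0 hcos)
      have h2 : 0 < (lam D - D * κ ^ 2 - V x) * Real.sin (κ * (x - c)) :=
        mul_pos (by linarith) hsin
      linarith)
  simp only [hκc, sub_self, mul_zero, Real.cos_zero, Real.sin_zero, Real.cos_pi_div_two,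
    hφ.neumann_one, zero_mul, sub_zero, mul_one] at h
  have h3 : 0 < Real.exp (m c / D) * (κ * φ c) :=
    mul_pos (Real.exp_pos _) (mul_pos hκ0 (hφ.pos c ⟨hc.1.le, hc.2.le⟩))
  linarith

/-- Asymptotic upper bound for the principal eigenvalue coming from the endpoint `0`, when it is an
equilibrium of the drift with expansion rate at most `b`. -/
theorem eventually_principalEigenvalue_lt_left (hm : ContDiffOn ℝ 2 m (Icc (0 : ℝ) 1))
    (hV : ContinuousOn V (Icc (0 : ℝ) 1))
    (hlam : ∀ D : ℝ, 0 < D → IsPrincipalEigenvalue m V D (lam D)) {b δ₀ : ℝ} (hb : 0 < b)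
    (hδ₀ : 0 < δ₀) (hmb : ∀ x ∈ Icc 0 δ₀, derivUnit m x ≤ b * x) {ε : ℝ} (hε : 0 < ε) :
    ∀ᶠ D in 𝓝[>] (0 : ℝ), lam D < V 0 + b + ε := by
  set e : ℝ := ε / 3 with he
  have he0 : 0 < e := by positivity
  obtain ⟨δ₁, hδ₁, hVδ⟩ := hV.exists_forall_Icc_zero
    (Iio_mem_nhds (show V 0 < V 0 + e by linarith))
  set δ : ℝ := min δ₀ δ₁ with hδ
  have hδ0 : 0 < δ := lt_min hδ₀ hδ₁.1
  set k : ℝ := b + e with hk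
  have hk0 : 0 < k := by positivity
  -- The truncation point is y = √(DZ). Lowering the Gaussian by g(y) costs (b + 2e)g(y), and Z is
  -- chosen so that the surplus e(1 + kz)g(x), z = x²/D, pays for it on all of (0, y).
  set Z : ℝ := 2 * (b + 2 * e) / (e * k) with hZ
  have hZ0 : 0 < Z := by positivity
  have hZe : e * (k * Z / 2) = b + 2 * e := by rw [hZ]; field_simp
  have hsmall : ∀ᶠ D in 𝓝[>] (0 : ℝ), √(D * Z) < δ := by
    have : Tendsto (fun D : ℝ => √(D * Z)) (𝓝[>] 0) (𝓝 (√(0 * Z))) :=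
      ((by fun_prop : Continuous fun D : ℝ => √(D * Z)).tendsto 0).mono_left nhdsWithin_le_nhds
    rw [zero_mul, Real.sqrt_zero] at this
    exact this.eventually (gt_mem_nhds hδ0)
  filter_upwards [hsmall, self_mem_nhdsWithin] with D hDs hD
  rw [mem_Ioi] at hD
  by_contra! hcon
  obtain ⟨φ, hφ⟩ := hlam D hD
  set y : ℝ := √(D * Z) with hy
  have hy0 : 0 < y := Real.sqrt_pos.2 (by positivity)
  have hysq : y ^ 2 = D * Z := Real.sq_sqrt (by positivity)
  have hy1 : y < 1 := hDs.trans_le ((min_le_right _ _).trans hδ₁.2.le)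
  set g : ℝ → ℝ := fun x => Real.exp (-(k * x ^ 2 / (2 * D))) with hg
  have hg0 : ∀ x, 0 < g x := fun x => Real.exp_pos _
  have hgd : ∀ x, HasDerivAt g (-(k * x / D) * g x) x := fun x => by
    have h1 : HasDerivAt (fun x : ℝ => -(k * x ^ 2 / (2 * D))) (-(k * x / D)) x := by
      have := ((((hasDerivAt_id x).pow 2).const_mul k).div_const (2 * D)).neg
      refine this.congr_deriv ?_
      simp only [id]
      field_simp
      norm_num
    exact h1.exp.congr_deriv (by ring)
  have hgd2 : ∀ x, HasDerivAt (fun x => -(k * x / D) * g x)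
      ((-(k / D) + k ^ 2 * x ^ 2 / D ^ 2) * g x) x := fun x => by
    have h1 : HasDerivAt (fun x : ℝ => -(k * x / D)) (-(k / D)) x := by
      exact (((hasDerivAt_id x).const_mul k).div_const D).neg.congr_deriv (by simp)
    refine (h1.mul (hgd x)).congr_deriv ?_
    field_simp
  have hgc : Continuous g := by fun_prop
  have hψpos : ∀ x ∈ Ioo 0 y, 0 < g x - g y := fun x hx => by
    refine sub_pos.2 (Real.exp_lt_exp.2 (neg_lt_neg ?_))
    gcongr
    · exact hx.1.le
    · exact hx.2
  have h := hφ.wronskian_lt (ψ := fun x => g x - g y)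
    (ψ₁ := fun x => -(k * x / D) * g x)
    (ψ₂ := fun x => (-(k / D) + k ^ 2 * x ^ 2 / D ^ 2) * g x) hm hD le_rfl hy0 hy1.le
    (by fun_prop) (fun x _ => (hgd x).sub_const _)
    (by fun_prop) (fun x _ => hgd2 x) (by
      intro x hx
      have hxδ : x ≤ δ := (hx.2.trans hDs).le
      have hV' : V x < V 0 + e := hVδ x ⟨hx.1.le, hxδ.trans (min_le_right _ _)⟩
      have hm' := hmb x ⟨hx.1.le, hxδ.trans (min_le_left _ _)⟩
      have h1 : 0 < (lam D - (b + 2 * e) - V x) * (g x - g y) :=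
        mul_pos (by linarith) (hψpos x hx)
      have h2 : 0 ≤ (b * x - derivUnit m x) * (k * x / D * g x) :=
        mul_nonneg (sub_nonneg.2 hm') (mul_nonneg (by have := hx.1; positivity) (hg0 x).le)
      set z : ℝ := x ^ 2 / D with hz
      have hz0 : 0 ≤ z := by positivity
      have hzZ : z ≤ Z := by
        rw [hz, div_le_iff₀ hD, mul_comm, ← hysq]
        have := hx.1
        gcongr
        exact hx.2.le
      have hgx : g x = g y * Real.exp (k * (Z - z) / 2) := by
        simp only [hg]
        rw [← Real.exp_add, hysq, hz]
        congr 1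
        field_simp
        ring
      have h3 : (b + 2 * e) * g y ≤ g x * (e * (1 + k * z)) := by
        have hA : 0 ≤ k * (Z - z) / 2 := by
          have := sub_nonneg.2 hzZ
          positivity
        have hB : 0 ≤ k * z := by positivity
        have hexp := Real.add_one_le_exp (k * (Z - z) / 2)
        -- With A = k(Z - z)/2 and B = kz one has A + B/2 = kZ/2, hence e(1 + A)(1 + B) ≥ ekZ/2 = b
        -- + 2e.
        have h4 : b + 2 * e ≤ Real.exp (k * (Z - z) / 2) * (e * (1 + k * z)) := by
          calc b + 2 * e ≤ (k * (Z - z) / 2 + 1) * (e * (1 + k * z)) := by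
                rw [← hZe]
                nlinarith [mul_nonneg he0.le (mul_nonneg hA hB), mul_nonneg he0.le hB]
            _ ≤ _ := by gcongr
        rw [hgx]
        nlinarith [mul_le_mul_of_nonneg_left h4 (hg0 y).le]
      have h5 : D * ((-(k / D) + k ^ 2 * x ^ 2 / D ^ 2) * g x) + b * x * (-(k * x / D) * g x)
          = g x * (e * (1 + k * z)) - (b + 2 * e) * g x := by
        rw [hz, hk]
        field_simp
        ring
      linarith)
  simp only [mul_zero, zero_div, neg_zero, zero_mul, hφ.neumann_zero, sub_self, sub_zero] at h
  have h3 : 0 < Real.exp (m y / D) * (k * y / D * g y * φ y) :=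
    mul_pos (Real.exp_pos _) (mul_pos (mul_pos (by positivity) (hg0 y))
      (hφ.pos y ⟨hy0.le, hy1.le⟩))
  linarith

end UpperBounds

/-! ### Riccati estimates and the lower bound -/

/-- The Riccati inequality satisfied near an unstable equilibrium by `g x = k x / (D + B x ^ 2)`. -/
theorem riccati_le_near_equilibrium {α B k s D x d : ℝ} (hB : 0 < B) (hs : 0 < s)
    (hk : 0 ≤ k) (hD : 0 < D) (hx : 0 ≤ x) (hd : α * x ≤ d)
    (h : k = 0 ∨ (B = s * α ∧ B + k = α)) :
    -D * (k * (D - B * x ^ 2) / (D + B * x ^ 2) ^ 2) + D * (k * x / (D + B * x ^ 2)) ^ 2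
      - d * (k * x / (D + B * x ^ 2)) ≤ -(k / (1 + s)) := by
  rcases h with rfl | ⟨hBs, hBk⟩
  · simp
  set q : ℝ := D + B * x ^ 2 with hq
  have hq0 : 0 < q := by positivity
  have h1 : α * x * (k * x / q) ≤ d * (k * x / q) := by gcongr
  -- The relation B + k = α cancels the Dx² terms of the numerator.
  have h2 : -D * (k * (D - B * x ^ 2) / q ^ 2) + D * (k * x / q) ^ 2 - α * x * (k * x / q)
      = -(k * (D ^ 2 + α * B * x ^ 4) / q ^ 2) := by
    rw [← hBk]
    field_simp
    rw [hq]
    ring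
  have h3 : k / (1 + s) ≤ k * (D ^ 2 + α * B * x ^ 4) / q ^ 2 := by
    rw [div_le_div_iff₀ (by positivity) (by positivity), mul_assoc]
    refine mul_le_mul_of_nonneg_left ?_ hk
    -- Since αB = B²/s, this is the weighted Cauchy–Schwarz bound (D + Bx²)² ≤ (1 + s)(D² + B²x⁴/s).
    have h4 : s * q ^ 2 ≤ s * ((D ^ 2 + α * B * x ^ 4) * (1 + s)) := by
      have : s * ((D ^ 2 + α * B * x ^ 4) * (1 + s))
          = (1 + s) * (s * D ^ 2 + B ^ 2 * x ^ 4) := by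
        rw [show s * ((D ^ 2 + α * B * x ^ 4) * (1 + s))
          = (1 + s) * (s * D ^ 2 + (s * α) * B * x ^ 4) by ring, ← hBs]
        ring
      rw [this, hq]
      nlinarith [sq_nonneg (s * D - B * x ^ 2)]
    exact le_of_mul_le_mul_left h4 hs
  linarith

/-- At distance δ from 0 both g and -g' are bounded independently of D, so g costs only O(D) there.
-/
theorem riccati_le_away {B k D δ x : ℝ} (hB : 0 < B) (hk : 0 ≤ k) (hD : 0 < D) (hδ : 0 < δ)
    (hx : δ ≤ x) :
    -D * (k * (D - B * x ^ 2) / (D + B * x ^ 2) ^ 2) + D * (k * x / (D + B * x ^ 2)) ^ 2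
      ≤ D * (k / (B * δ ^ 2) + (k / (B * δ)) ^ 2) := by
  have hx0 : 0 < x := hδ.trans_le hx
  have hq : 0 < D + B * x ^ 2 := by positivity
  have hqδ : B * δ ^ 2 ≤ D + B * x ^ 2 := by
    have : B * δ ^ 2 ≤ B * x ^ 2 := by gcongr
    linarith
  have h2 : -(k * (D - B * x ^ 2) / (D + B * x ^ 2) ^ 2) ≤ k / (B * δ ^ 2) := by
    calc -(k * (D - B * x ^ 2) / (D + B * x ^ 2) ^ 2) ≤ k / (D + B * x ^ 2) := by
          rw [← neg_div, div_le_div_iff₀ (pow_pos hq 2) hq]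
          have : 0 ≤ 2 * (k * D * (D + B * x ^ 2)) := by positivity
          linarith
      _ ≤ _ := by gcongr
  have h3 : k * x / (D + B * x ^ 2) ≤ k / (B * δ) := by
    calc k * x / (D + B * x ^ 2) ≤ k / (B * x) := by
          rw [div_le_div_iff₀ hq (by positivity)]
          have : 0 ≤ k * D := by positivity
          linarith
      _ ≤ _ := by gcongr
  have h4 : (k * x / (D + B * x ^ 2)) ^ 2 ≤ (k / (B * δ)) ^ 2 := by
    have : 0 ≤ k * x / (D + B * x ^ 2) := by positivity
    gcongr
  have h5 := mul_le_mul_of_nonneg_left (add_le_add h2 h4) hD.le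
  linarith

/-- Young's inequality √D·x ≤ D + x² makes Dg = O(√√D²) = O(√D) uniformly in x; this controls the
cross terms of Dw² that are linear in g. -/
theorem mul_div_le_mul_sqrt {B k D x : ℝ} (hB : 0 < B) (hk : 0 ≤ k) (hD : 0 < D) :
    D * (k * x / (D + B * x ^ 2)) ≤ k * (1 + 1 / B) * √D := by
  have hsq : √D ^ 2 = D := Real.sq_sqrt hD.le
  have h1 : √D * x ≤ (1 + 1 / B) * (D + B * x ^ 2) := by
    have : (1 + 1 / B) * (D + B * x ^ 2) = D + B * x ^ 2 + D / B + x ^ 2 := by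
      field_simp
      ring
    rw [this]
    have h2 : 0 ≤ B * x ^ 2 := by positivity
    have h3 : 0 ≤ D / B := by positivity
    nlinarith [sq_nonneg (√D - x), sq_nonneg x]
  rw [mul_div_assoc', div_le_iff₀ (by positivity)]
  calc D * (k * x) = k * √D * (√D * x) := by linear_combination -(k * x) * hsq
    _ ≤ k * √D * ((1 + 1 / B) * (D + B * x ^ 2)) := by gcongr
    _ = _ := by ring

/-- Expansion of D(w' + w²) + dw for w = -(1 - x)(K + G). Using (1 - x)² ≤ 1 - x on G² factors out
the Riccati expression of G alone; the remaining terms are small with D and S. -/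
theorem riccati_logDeriv_le {D K G G' S d x : ℝ} (hD : 0 ≤ D) (hK : 0 ≤ K) (hG : 0 ≤ G)
    (hx : 0 ≤ x) (hx1 : 0 ≤ 1 - x) (hS : D * G ≤ S) :
    D * (-(-1 * (K + G) + (1 - x) * G') + (-((1 - x) * (K + G))) ^ 2) + d * -((1 - x) * (K + G))
      ≤ D * K + D * K ^ 2 + (1 + 2 * K) * S
        + (1 - x) * (-D * G' + D * G ^ 2 - d * G - d * K) := by
  have h1 : (1 + 2 * K) * (D * G) ≤ (1 + 2 * K) * S := by gcongr
  have h2 : (1 - x) ^ 2 * (D * (K ^ 2 + 2 * K * G)) ≤ 1 * (D * (K ^ 2 + 2 * K * G)) :=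
    mul_le_mul_of_nonneg_right (by nlinarith) (by positivity)
  have h3 : (1 - x) ^ 2 * (D * G ^ 2) ≤ (1 - x) * (D * G ^ 2) :=
    mul_le_mul_of_nonneg_right (by nlinarith) (by positivity)
  linarith

section LowerBound

variable {m V lam : ℝ → ℝ}

/-- Comparison with a positive supersolution given by its logarithmic derivative `w`. -/
theorem IsPositiveEigenfunction.exists_of_logDeriv {D μ : ℝ} {φ w w' : ℝ → ℝ}
    (hφ : IsPositiveEigenfunction m V D μ φ) (hm : ContDiffOn ℝ 2 m (Icc (0 : ℝ) 1)) (hD : 0 < D)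
    (hwc : Continuous w) (hw : ∀ x, HasDerivAt w (w' x) x) (hw0 : w 0 ≤ 0) (hw1 : w 1 = 0) :
    ∃ x ∈ Ioo (0 : ℝ) 1, V x - μ ≤ D * (w' x + w x ^ 2) + derivUnit m x * w x := by
  by_contra! hcon
  -- ψ has logarithmic derivative w, so Dψ'' + m'ψ' = (D(w' + w²) + m'w)ψ. If the claim failed, -ψ
  -- would be a strict subsolution with Wronskian nonnegative at 0 and zero at 1.
  set ψ : ℝ → ℝ := fun x => Real.exp (∫ t in (0 : ℝ)..x, w t) with hψ
  have hψ0 : ∀ x, 0 < ψ x := fun x => Real.exp_pos _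
  have hψd : ∀ x, HasDerivAt ψ (w x * ψ x) x := fun x => by
    refine (intervalIntegral.integral_hasDerivAt_right (hwc.intervalIntegrable 0 x)
      hwc.aestronglyMeasurable.stronglyMeasurableAtFilter hwc.continuousAt).exp.congr_deriv ?_
    rw [hψ, mul_comm]
  have hψc : Continuous ψ := continuous_iff_continuousAt.2 fun x => (hψd x).continuousAt
  have h := hφ.wronskian_lt (ψ := fun x => -ψ x) (ψ₁ := fun x => -(w x * ψ x))
    (ψ₂ := fun x => -(w' x * ψ x + w x * (w x * ψ x))) hm hD le_rfl zero_lt_one le_rfl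
    (by fun_prop) (fun x _ => (hψd x).neg) (by fun_prop) (fun x _ => ((hw x).mul (hψd x)).neg) (by
      intro x hx
      have := mul_lt_mul_of_pos_right (hcon x hx) (hψ0 x)
      linarith)
  simp only [hφ.neumann_zero, hφ.neumann_one, hw1, zero_mul, neg_zero, mul_zero, sub_zero] at h
  have h3 : 0 ≤ Real.exp (m 0 / D) * (-(w 0 * ψ 0) * φ 0) :=
    mul_nonneg (Real.exp_pos _).le (mul_nonneg
      (neg_nonneg.2 (mul_nonpos_of_nonpos_of_nonneg hw0 (hψ0 0).le)) (hφ.pos 0 (by simp)).le)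
  linarith

/-- Asymptotic lower bound for the principal eigenvalue, when the drift expands at rate at least
`α` near `0`. -/
theorem eventually_lt_principalEigenvalue (hm : ContDiffOn ℝ 2 m (Icc (0 : ℝ) 1))
    (hV : ContinuousOn V (Icc (0 : ℝ) 1)) (hm_pos : ∀ x ∈ Ioo (0 : ℝ) 1, 0 < derivUnit m x)
    (hlam : ∀ D : ℝ, 0 < D → IsPrincipalEigenvalue m V D (lam D)) {α δ₀ : ℝ} (hα : 0 ≤ α)
    (hδ₀ : 0 < δ₀) (hmα : ∀ x ∈ Icc 0 δ₀, α * x ≤ derivUnit m x) {ε : ℝ} (hε : 0 < ε) :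
    ∀ᶠ D in 𝓝[>] (0 : ℝ), min (V 0 + α) (V 1) - ε < lam D := by
  set e : ℝ := ε / 4 with he
  have he0 : 0 < e := by positivity
  set s : ℝ := e / (2 * α + e) with hs
  have hs0 : 0 < s := by positivity
  have hs1 : s ≤ 1 := by
    rw [hs, div_le_one (by positivity)]
    linarith
  have hαs : 2 * α * s ≤ e := by
    rw [hs, mul_div_assoc', div_le_iff₀ (by positivity)]
    nlinarith
  -- For α = 0 no gain is needed and g = 0. Otherwise k/(1 + s) = α(1 - s)/(1 + s), within e of α
  -- because 2αs ≤ e.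
  obtain ⟨B, k, hB, hk, hBk, hκ⟩ : ∃ B k : ℝ, 0 < B ∧ 0 ≤ k ∧
      (k = 0 ∨ (B = s * α ∧ B + k = α)) ∧ α - e ≤ k / (1 + s) := by
    rcases hα.eq_or_lt with rfl | hα'
    · exact ⟨1, 0, one_pos, le_rfl, Or.inl rfl, by simp [he0.le]⟩
    · refine ⟨s * α, (1 - s) * α, by positivity, mul_nonneg (by linarith) hα,
        Or.inr ⟨rfl, by ring⟩, ?_⟩
      rw [le_div_iff₀ (by positivity)]
      nlinarith [mul_pos he0 hs0]
  set κ : ℝ := k / (1 + s) with hκdef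
  have hκ0 : 0 ≤ κ := by positivity
  obtain ⟨M, hM⟩ := isCompact_Icc.exists_bound_of_continuousOn hV
  have hM0 : 0 ≤ M := (norm_nonneg _).trans (hM 0 (by simp))
  have hMl : ∀ x ∈ Icc (0 : ℝ) 1, -M ≤ V x ∧ V x ≤ M := fun x hx => abs_le.1 (hM x hx)
  obtain ⟨δ₁, hδ₁, hVδ⟩ := hV.exists_forall_Icc_zero
    (Ioi_mem_nhds (show V 0 - e < V 0 by linarith))
  obtain ⟨c, hc, hVc⟩ := hV.exists_forall_Icc_one
    (Ioi_mem_nhds (show V 1 - e < V 1 by linarith))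
  have h1c : 0 < 1 - c := sub_pos.2 hc.2
  set δ : ℝ := min (min δ₀ δ₁) (e / (κ + 1)) with hδ
  have hδ0 : 0 < δ := lt_min (lt_min hδ₀ hδ₁.1) (by positivity)
  have hδκ : δ * κ ≤ e := by
    calc δ * κ ≤ e / (κ + 1) * (κ + 1) := by
          gcongr
          · exact min_le_right _ _
          · linarith
      _ = e := by field_simp
  obtain ⟨ρ, hρ, hmρ⟩ : ∃ ρ, 0 < ρ ∧ ∀ x ∈ Icc δ c, ρ ≤ derivUnit m x :=
    isCompact_Icc.exists_forall_le'
      (hm.derivUnit_continuousOn.mono (Icc_subset_Icc hδ0.le hc.2.le))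
      fun x hx => hm_pos x ⟨hδ0.trans_le hx.1, hx.2.trans_lt hc.2⟩
  -- On [δ, c] the drift term is at most -(1 - c)ρK = -(2M + e), which outweighs the oscillation of
  -- V.
  set K : ℝ := (2 * M + e) / (ρ * (1 - c)) with hK
  have hK0 : 0 < K := by positivity
  have hKρ : (1 - c) * (ρ * K) = 2 * M + e := by rw [hK]; field_simp
  set C : ℝ := k / (B * δ ^ 2) + (k / (B * δ)) ^ 2 with hC
  have hC0 : 0 ≤ C := by positivity
  have hsmall : ∀ᶠ D in 𝓝[>] (0 : ℝ),
      D * K + D * K ^ 2 + (1 + 2 * K) * (k * (1 + 1 / B) * √D) + D * C < e := by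
    have : Tendsto (fun D : ℝ =>
        D * K + D * K ^ 2 + (1 + 2 * K) * (k * (1 + 1 / B) * √D) + D * C) (𝓝[>] 0)
        (𝓝 (0 * K + 0 * K ^ 2 + (1 + 2 * K) * (k * (1 + 1 / B) * √0) + 0 * C)) :=
      ((by fun_prop : Continuous fun D : ℝ =>
        D * K + D * K ^ 2 + (1 + 2 * K) * (k * (1 + 1 / B) * √D) + D * C).tendsto 0).mono_left
        nhdsWithin_le_nhds
    simp only [zero_mul, Real.sqrt_zero, mul_zero, add_zero] at this
    exact this.eventually (gt_mem_nhds he0)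
  filter_upwards [hsmall, self_mem_nhdsWithin] with D hDs hD
  rw [mem_Ioi] at hD
  by_contra! hcon
  have hlam0 : lam D ≤ V 0 + α - ε := hcon.trans (sub_le_sub_right (min_le_left _ _) _)
  have hlam1 : lam D ≤ V 1 - ε := hcon.trans (sub_le_sub_right (min_le_right _ _) _)
  obtain ⟨φ, hφ⟩ := hlam D hD
  have hq : ∀ x : ℝ, 0 < D + B * x ^ 2 := fun x => by positivity
  set g : ℝ → ℝ := fun x => k * x / (D + B * x ^ 2) with hg
  set g' : ℝ → ℝ := fun x => k * (D - B * x ^ 2) / (D + B * x ^ 2) ^ 2 with hg'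
  have hgd : ∀ x, HasDerivAt g (g' x) x := fun x => by
    have h1 : HasDerivAt (fun x : ℝ => k * x) k x := by
      simpa using (hasDerivAt_id x).const_mul k
    have h2 : HasDerivAt (fun x : ℝ => D + B * x ^ 2) (B * (2 * x)) x := by
      simpa using (((hasDerivAt_id x).pow 2).const_mul B).const_add D
    refine (h1.div h2 (hq x).ne').congr_deriv ?_
    rw [hg']
    congr 1
    ring
  have hgc : Continuous g := continuous_iff_continuousAt.2 fun x => (hgd x).continuousAt
  obtain ⟨x, hx, hle⟩ := hφ.exists_of_logDeriv hm hD (w := fun x => -((1 - x) * (K + g x)))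
    (w' := fun x => -(-1 * (K + g x) + (1 - x) * g' x)) (by fun_prop)
    (fun x => (((hasDerivAt_id x).const_sub 1).mul ((hgd x).const_add K)).neg)
    (by simp [hg, hK0.le]) (by simp)
  have hx' := Ioo_subset_Icc_self hx
  have hx0 := hx.1
  have hx1 : 0 < 1 - x := sub_pos.2 hx.2
  have hg0 : 0 ≤ g x := by positivity
  have hm0 := hm_pos x hx
  have hmain := riccati_logDeriv_le (d := derivUnit m x) (G' := g' x) hD.le hK0.le hg0 hx0.le
    hx1.le (mul_div_le_mul_sqrt hB hk hD)
  have hDC : 0 ≤ D * C := by positivity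
  rcases le_total x δ with hxδ | hxδ
  · have hV' : V 0 - e < V x := hVδ x
      ⟨hx0.le, hxδ.trans ((min_le_left _ _).trans (min_le_right _ _))⟩
    have hr := riccati_le_near_equilibrium hB hs0 hk hD hx0.le
      (hmα x ⟨hx0.le, hxδ.trans ((min_le_left _ _).trans (min_le_left _ _))⟩) hBk
    have h1 : (1 - x) * (-D * g' x + D * g x ^ 2 - derivUnit m x * g x - derivUnit m x * K)
        ≤ (1 - x) * -κ := by
      refine mul_le_mul_of_nonneg_left ?_ hx1.le
      have := mul_pos hm0 hK0
      linarith
    have h2 : x * κ ≤ δ * κ := by gcongr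
    linarith
  · have h1 : -D * g' x + D * g x ^ 2 ≤ D * C := riccati_le_away hB hk hD hδ0 hxδ
    have h2 : (1 - x) * (-D * g' x + D * g x ^ 2 - derivUnit m x * g x - derivUnit m x * K)
        ≤ D * C - (1 - x) * (derivUnit m x * K) := by
      have h3 : (1 - x) * (-D * g' x + D * g x ^ 2) ≤ (1 - x) * (D * C) := by gcongr
      have h4 : 0 ≤ x * (D * C) := by positivity
      have h5 : 0 ≤ (1 - x) * (derivUnit m x * g x) := by positivity
      linarith
    rcases le_total x c with hxc | hxc
    · have h3 : (1 - c) * (ρ * K) ≤ (1 - x) * (derivUnit m x * K) := by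
        have := hmρ x ⟨hxδ, hxc⟩
        gcongr
      have h4 := (hMl x hx').1
      have h5 := (hMl 1 (by simp)).2
      linarith
    · have hV' : V 1 - e < V x := hVc x ⟨hxc, hx.2.le⟩
      have h3 : 0 ≤ (1 - x) * (derivUnit m x * K) := by positivity
      linarith

end LowerBound

/-! ### Drift near 0 and the limit -/

/-- Differentiability of m' at 0 supplies the linear bounds on the drift that the two estimates at 0
require. -/
theorem ContDiffOn.exists_abs_derivUnit_sub_le {m : ℝ → ℝ}
    (hm : ContDiffOn ℝ 2 m (Icc (0 : ℝ) 1)) (h0 : derivUnit m 0 = 0) {c : ℝ} (hc : 0 < c) :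
    ∃ δ > 0, ∀ x ∈ Icc 0 δ, |derivUnit m x - derivUnit (derivUnit m) 0 * x| ≤ c * x := by
  have hd : HasDerivWithinAt (derivUnit m) (derivUnit (derivUnit m) 0) (Icc 0 1) 0 :=
    (hm.derivUnit_one.differentiableOn (by norm_num) 0 (by simp)).hasDerivWithinAt
  have h := (hasDerivWithinAt_iff_isLittleO.1 hd).def hc
  rw [nhdsWithin_Icc_eq_nhdsGE zero_lt_one] at h
  obtain ⟨u, hu, hu'⟩ := (mem_nhdsGE_iff_exists_Icc_subset).1 h
  refine ⟨u, hu, fun x hx => ?_⟩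
  have := hu' hx
  simp only [mem_ofPred_eq, h0, sub_zero, smul_eq_mul, Real.norm_eq_abs, abs_of_nonneg hx.1] at this
  rwa [mul_comm x] at this

/-- Excludes the `⊥` branch of `secondDerivAtZero`. -/
theorem derivUnit_zero_nonneg {m : ℝ → ℝ} (hm : ContDiffOn ℝ 2 m (Icc (0 : ℝ) 1))
    (hm_pos : ∀ x ∈ Ioo (0 : ℝ) 1, 0 < derivUnit m x) : 0 ≤ derivUnit m 0 := by
  by_contra! h
  obtain ⟨δ, hδ, hneg⟩ := hm.derivUnit_continuousOn.exists_forall_Icc_zero (Iio_mem_nhds h)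
  exact lt_asymm (hm_pos δ hδ) (hneg δ (right_mem_Icc.2 hδ.1.le))

theorem corollary2p5 (m V : ℝ → ℝ)
    (hm : ContDiffOn ℝ 2 m (Icc (0 : ℝ) 1))
    (hV : ContinuousOn V (Icc (0 : ℝ) 1))
    (hm_pos : ∀ x ∈ Ioo (0 : ℝ) 1, 0 < derivUnit m x) :
    (∀ D : ℝ, 0 < D → ∃! μ : ℝ, IsPrincipalEigenvalue m V D μ) ∧
    ∀ lam : ℝ → ℝ, (∀ D : ℝ, 0 < D → IsPrincipalEigenvalue m V D (lam D)) →
      Tendsto (fun D : ℝ => ((lam D : ℝ) : EReal)) (𝓝[>] (0 : ℝ))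
        (𝓝 (min ((V 0 : EReal) + erealPosPart (secondDerivAtZero m)) (V 1 : EReal))) := by
  refine ⟨fun D hD => ?_, fun lam hlam => ?_⟩
  · obtain ⟨μ, hμ⟩ := exists_isPrincipalEigenvalue hm hV hD
    exact ⟨μ, hμ, fun ν hν => hν.eq hm hD hμ⟩
  obtain ⟨L, hL, hlow, hupp⟩ : ∃ L : ℝ,
      min ((V 0 : EReal) + erealPosPart (secondDerivAtZero m)) (V 1 : EReal) = L ∧
      (∀ ε > 0, ∀ᶠ D in 𝓝[>] (0 : ℝ), L - ε < lam D) ∧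
      ∀ ε > 0, ∀ᶠ D in 𝓝[>] (0 : ℝ), lam D < L + ε := by
    have hright : ∀ ε > 0, ∀ᶠ D in 𝓝[>] (0 : ℝ), lam D < V 1 + ε := fun ε hε =>
      eventually_principalEigenvalue_lt_right hm hV hm_pos hlam hε
    rcases (derivUnit_zero_nonneg hm hm_pos).eq_or_lt with h0 | h0
    · set r := derivUnit (derivUnit m) 0 with hr
      have hsec : secondDerivAtZero m = (r : EReal) := by
        simp [secondDerivAtZero, ← h0, hr]
      refine ⟨min (V 0 + max r 0) (V 1), ?_, fun ε hε => ?_, fun ε hε => ?_⟩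
      · rw [hsec, erealPosPart, EReal.coe_strictMono.monotone.map_min, EReal.coe_add,
          EReal.coe_strictMono.monotone.map_max, EReal.coe_zero]
      · obtain ⟨δ, hδ, hδm⟩ := hm.exists_abs_derivUnit_sub_le h0.symm (half_pos hε)
        have hmα : ∀ x ∈ Icc 0 (min δ (1 / 2)), max (r - ε / 2) 0 * x ≤ derivUnit m x := by
          intro x hx
          rw [max_mul_of_nonneg _ _ hx.1, zero_mul]
          refine max_le ?_ ?_
          · have := (abs_le.1 (hδm x ⟨hx.1, hx.2.trans (min_le_left _ _)⟩)).1
            linarith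
          · rcases hx.1.eq_or_lt with rfl | hx0
            · exact h0.le
            · exact (hm_pos x ⟨hx0, (hx.2.trans (min_le_right _ _)).trans_lt (by norm_num)⟩).le
        filter_upwards [eventually_lt_principalEigenvalue hm hV hm_pos hlam (le_max_right _ _)
          (lt_min hδ (by norm_num)) hmα (half_pos hε)] with D hD
        refine lt_of_le_of_lt ?_ hD
        have h1 : max r 0 - ε / 2 ≤ max (r - ε / 2) 0 := by
          rcases le_total r 0 with h | h
          · rw [max_eq_right h]
            exact le_max_of_le_right (by linarith)
          · rw [max_eq_left h]
            exact le_max_left _ _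
        have h2 : min (V 0 + max r 0) (V 1) - ε / 2 ≤ min (V 0 + max (r - ε / 2) 0) (V 1) := by
          refine le_min ?_ ?_
          · linarith [min_le_left (V 0 + max r 0) (V 1)]
          · linarith [min_le_right (V 0 + max r 0) (V 1)]
        linarith
      · obtain ⟨δ, hδ, hδm⟩ := hm.exists_abs_derivUnit_sub_le h0.symm (half_pos hε)
        have hmb : ∀ x ∈ Icc 0 δ, derivUnit m x ≤ (max r 0 + ε / 2) * x := by
          intro x hx
          have h1 := (abs_le.1 (hδm x hx)).2
          have h2 := mul_le_mul_of_nonneg_right (le_max_left r 0) hx.1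
          linarith
        have hb : 0 < max r 0 + ε / 2 := by
          have := le_max_right r 0
          linarith
        filter_upwards [eventually_principalEigenvalue_lt_left hm hV hlam hb hδ hmb (half_pos hε),
          hright ε hε] with D hD1 hD2
        rw [← min_add_add_right]
        exact lt_min (by linarith) hD2
    · refine ⟨V 1, ?_, fun ε hε => ?_, hright⟩
      · simp [secondDerivAtZero, h0, erealPosPart]
      · obtain ⟨δ, hδ, hδm⟩ := hm.derivUnit_continuousOn.exists_forall_Icc_zero
          (Ioi_mem_nhds (half_lt_self h0))
        -- When m'(0) > 0, the drift dominates αx near 0 for every α; this choice makes V(0) + α ≥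
        -- V(1), so the minimum is V(1).
        set α : ℝ := max (V 1 - V 0) 0 with hα
        have hα0 : 0 ≤ α := le_max_right _ _
        have hδ' : 0 < min δ (derivUnit m 0 / 2 / (α + 1)) := lt_min hδ.1 (by positivity)
        have hmα : ∀ x ∈ Icc 0 (min δ (derivUnit m 0 / 2 / (α + 1))),
            α * x ≤ derivUnit m x := by
          intro x hx
          have h1 : derivUnit m 0 / 2 < derivUnit m x := hδm x ⟨hx.1, hx.2.trans (min_le_left _ _)⟩
          have h2 := hx.2.trans (min_le_right _ _)
          rw [le_div_iff₀ (by positivity)] at h2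
          linarith [hx.1]
        filter_upwards [eventually_lt_principalEigenvalue hm hV hm_pos hlam hα0 hδ' hmα hε]
          with D hD
        rwa [min_eq_right (by linarith [le_max_left (V 1 - V 0) 0])] at hD
  rw [hL]
  refine (continuous_coe_real_ereal.tendsto L).comp
    (tendsto_order.2 ⟨fun a ha => ?_, fun a ha => ?_⟩)
  · simpa using hlow (L - a) (sub_pos.2 ha)
  · simpa using hupp (a - L) (sub_pos.2 ha)
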